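/- Let $\mathbb{K}$ be $\mathbb{R}$ or $\mathbb{C}$. For $p\in[1,\infty]$ let $p^*$ be the conjugate exponent, $1/p+1/p^*=1$ (with $1/\infty=0$), let $\ell_p^n$ be $\mathbb{K}^n$ with the $p$-norm, and let $\|A\|=\sup\{|A(x,y)| : \|x\|_{p_1}\le 1,\ \|y\|_{p_2}\le 1\}$ for a bilinear form $A\colon\ell_{p_1}^{n_1}\times\ell_{p_2}^{n_2}\to\mathbb{K}$. Put $$B(p_1,p_2,n_1,n_2)=\max\left\{n_2^{1/p_2^*}\,n_1^{\max\{\frac12-\frac1{p_1},0\}},\ n_1^{1/p_1^*}\,n_2^{\max\{\frac12-\frac1{p_2},0\}}\right\}.$$ For every $\epsilon>0$ there exists a positive integer $N$, depending only on $\epsilon$, such that the following holds for all positive integers $n_1,n_2$. (i) If $1\le p_1\le p_2\le 2$, $n_2>N$ and $n_1\le n_2$, then $B(p_1,p_2,n_1,n_2)=n_2^{1/p_2^*}$ and there is a bilinear form $A\colon\ell_{p_1}^{n_1}\times\ell_{p_2}^{n_2}\to\mathbb{K}$ of the type $$A(x,y)=\sum_{i=1}^{n_1}\sum_{j=1}^{n_2}\pm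 x_iy_j$$ such that $\|A\|\le(1+\epsilon)\,B(p_1,p_2,n_1,n_2)$. (ii) Symmetrically, if $1\le p_2\le p_1\le 2$, $n_1>N$ and $n_2\le n_1$, then $B(p_1,p_2,n_1,n_2)=n_1^{1/p_1^*}$ and there is a bilinear form $A\colon\ell_{p_1}^{n_1}\times\ell_{p_2}^{n_2}\to\mathbb{K}$ of the same type such that $\|A\|\le(1+\epsilon)\,B(p_1,p_2,n_1,n_2)$. -/

import Mathlib

open scoped ENNReal

noncomputable section

/-- A continuous bilinear form on `ℓ_{p₁}^{n₁} × ℓ_{p₂}^{n₂}`, in curried form; `‖A‖` is the usual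
norm of a bilinear form, the supremum of `|A(x, y)|` over the product of the unit balls. -/
abbrev BilinForm (𝕜 : Type*) [RCLike 𝕜] (p₁ p₂ : ℝ≥0∞) [Fact (1 ≤ p₁)] [Fact (1 ≤ p₂)]
    (n₁ n₂ : ℕ) : Type _ :=
  PiLp p₁ (fun _ : Fin n₁ => 𝕜) →L[𝕜] PiLp p₂ (fun _ : Fin n₂ => 𝕜) →L[𝕜] 𝕜

/-- `A(x, y) = ∑ i, ∑ j, ± x i * y j`. -/
def HasSignCoefficients {𝕜 : Type*} [RCLike 𝕜] {p₁ p₂ : ℝ≥0∞} [Fact (1 ≤ p₁)] [Fact (1 ≤ p₂)]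
    {n₁ n₂ : ℕ} (A : BilinForm 𝕜 p₁ p₂ n₁ n₂) : Prop :=
  ∃ s : Fin n₁ → Fin n₂ → 𝕜, (∀ i j, s i j = 1 ∨ s i j = -1) ∧
    ∀ (x : PiLp p₁ (fun _ : Fin n₁ => 𝕜)) (y : PiLp p₂ (fun _ : Fin n₂ => 𝕜)),
      A x y = ∑ i, ∑ j, s i j * x i * y j

/-- The real number `1 / p`, with `1 / ∞ = 0`. -/
def recip (p : ℝ≥0∞) : ℝ := (p⁻¹).toReal

/-- `max {n₂^(1/p₂*) n₁^(max{1/2 - 1/p₁, 0}), n₁^(1/p₁*) n₂^(max{1/2 - 1/p₂, 0})}`, where `p*` is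
the conjugate exponent of `p`. -/
def bennettBound (p₁ p₂ : ℝ≥0∞) (n₁ n₂ : ℕ) : ℝ :=
  max ((n₂ : ℝ) ^ recip p₂.conjExponent * (n₁ : ℝ) ^ max (1 / 2 - recip p₁) 0)
    ((n₁ : ℝ) ^ recip p₁.conjExponent * (n₂ : ℝ) ^ max (1 / 2 - recip p₂) 0)

end

/-! Cut the sign matrix out of a Hadamard matrix of order `m`, where `m` is at least the larger
dimension `n` and at most `(1 + ε) * n`. Orthogonality bounds the form by `√m` on ℓ₂ × ℓ₂, and the
unit coefficients bound it by 1 on ℓ₁ × ℓ₁; complex interpolation gives `m ^ (1 - 1/q)` on ℓ_q × ℓ_q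
for `1 ≤ q ≤ 2`. With `q` the larger exponent, both unit balls lie in ℓ_q balls, so the loss is at
most `(1 + ε) ^ (1 - 1/q) ≤ 1 + ε`. Such `m` exist because 2 and 12 are multiplicatively independent
Hadamard orders: the products `2 ^ a * 12 ^ b` have consecutive ratios tending to 1
(`exists_isHadamardOrder_between`). -/

/-! ### Hadamard orders and their products -/

/-- There is a `±1` Hadamard matrix of order `n`. -/
def IsHadamardOrder (n : ℕ) : Prop :=
  ∃ H : Matrix (Fin n) (Fin n) ℤ, H.IsHadamard

/-- The quadratic-residue (Paley) matrix of order `12`. -/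
def paleyTwelve (i j : Fin 12) : ℤ :=
  if i.val = 0 then 1 else if j.val = 0 then -1 else
    if (i.val + 11 - j.val) % 11 ∈ [0, 1, 3, 4, 5, 9] then 1 else -1

theorem isHadamard_of_rows {n : ℕ} (hn : n ≠ 0) (H : Fin n → Fin n → ℤ)
    (h₁ : ∀ i j, H i j = 1 ∨ H i j = -1)
    (h₂ : ∀ i j, ∑ k, H i k * H j k = if i = j then (n : ℤ) else 0) :
    (Matrix.of H).IsHadamard := by
  refine Matrix.IsHadamard.of_mul_conjTranspose
    (fun i j => Unitary.mem_iff_eq_one_or_eq_neg_one.mpr (h₁ i j)) ?_ ?_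
  · ext i j
    rw [Matrix.mul_apply]
    simp only [Matrix.of_apply, Matrix.conjTranspose_apply, star_trivial, h₂,
      Matrix.smul_apply, Matrix.one_apply, Fintype.card_fin]
    split_ifs <;> simp
  · rw [isRegular_iff_ne_zero]
    simpa using hn

theorem isHadamardOrder_one : IsHadamardOrder 1 :=
  ⟨_, isHadamard_of_rows (by norm_num) (fun _ _ => 1) (by decide) (by decide)⟩

theorem isHadamardOrder_two : IsHadamardOrder 2 :=
  ⟨_, isHadamard_of_rows (by norm_num) ![![1, 1], ![1, -1]] (by decide) (by decide)⟩

theorem isHadamardOrder_twelve : IsHadamardOrder 12 :=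
  ⟨_, isHadamard_of_rows (by norm_num) paleyTwelve (by decide +kernel) (by decide +kernel)⟩

theorem IsHadamardOrder.mul {m n : ℕ} (hm : IsHadamardOrder m) (hn : IsHadamardOrder n) :
    IsHadamardOrder (m * n) := by
  obtain ⟨A, hA⟩ := hm
  obtain ⟨B, hB⟩ := hn
  exact ⟨_, (hA.kronecker hB).reindex finProdFinEquiv finProdFinEquiv⟩

theorem IsHadamardOrder.pow {m : ℕ} (hm : IsHadamardOrder m) (k : ℕ) :
    IsHadamardOrder (m ^ k) := by
  induction k with
  | zero => exact isHadamardOrder_one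
  | succ k ih => exact ih.mul hm

/-! ### Multiplicative gaps between Hadamard orders -/

/-- If `P ^ u / Q ^ v` is slightly larger than `1`, the numbers `P ^ a * Q ^ b` leave only small
multiplicative gaps. -/
theorem exists_pow_mul_pow_between {P Q : ℕ} (hQ : 1 < Q) {ε : ℝ} {u v : ℕ}
    (h₁ : (Q : ℝ) ^ v < (P : ℝ) ^ u) (h₂ : (P : ℝ) ^ u ≤ (1 + ε) * (Q : ℝ) ^ v) :
    ∃ N : ℕ, ∀ n : ℕ, N < n → ∃ a b : ℕ, n ≤ P ^ a * Q ^ b ∧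
      ((P ^ a * Q ^ b : ℕ) : ℝ) ≤ (1 + ε) * n := by
  have hQ0 : (0 : ℝ) < Q := by positivity
  have hε : 0 < ε := by
    have : (0 : ℝ) < (Q : ℝ) ^ v := by positivity
    by_contra hc
    nlinarith
  set r : ℝ := (P : ℝ) ^ u / (Q : ℝ) ^ v with hr
  have hr1 : 1 < r := by rw [hr, one_lt_div (by positivity)]; exact h₁
  have hrε : r ≤ 1 + ε := by rw [hr, div_le_iff₀ (by positivity)]; exact h₂
  obtain ⟨K, hK⟩ := pow_unbounded_of_one_lt (Q : ℝ) hr1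
  -- Beyond this threshold there are enough factors `Q` to trade `Q ^ v` for `P ^ u` up to `K`
  -- times; each trade multiplies by `r`, and `K` trades gain more than a factor `Q`.
  refine ⟨Q ^ (v * K), fun n hn => ?_⟩
  obtain ⟨j, hj₁, hj₂⟩ : ∃ j : ℕ, Q ^ (v * K + j) ≤ n ∧ n < Q ^ (v * K + j + 1) := by
    have hle : v * K ≤ Nat.log Q n := Nat.le_log_of_pow_le hQ hn.le
    refine ⟨Nat.log Q n - v * K, ?_, ?_⟩
    · rw [Nat.add_sub_cancel' hle]
      exact Nat.pow_log_le_self Q (by omega)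
    · rw [Nat.add_sub_cancel' hle]
      exact Nat.lt_pow_succ_log_self hQ n
  set c : ℝ := (Q : ℝ) ^ (v * K + j) with hc
  have hc0 : 0 < c := by positivity
  have hcn : c ≤ n := by rw [hc]; exact_mod_cast hj₁
  have hnK : (n : ℝ) ≤ c * r ^ K := by
    have h : (n : ℝ) < (Q : ℝ) ^ (v * K + j + 1) := by exact_mod_cast hj₂
    rw [pow_succ] at h
    exact h.le.trans (by gcongr)
  have hex : ∃ k : ℕ, (n : ℝ) ≤ c * r ^ k := ⟨K, hnK⟩
  classical
  have hkK : Nat.find hex ≤ K := Nat.find_min' hex hnK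
  -- By minimality of `k`, the product overshoots `n` by at most one factor `r ≤ 1 + ε`.
  set k := Nat.find hex with hk
  have hkn : (n : ℝ) ≤ c * r ^ k := Nat.find_spec hex
  have hkub : c * r ^ k ≤ (1 + ε) * n := by
    rcases Nat.eq_zero_or_pos k with h0 | hpos
    · rw [h0, pow_zero, mul_one]
      have : (0 : ℝ) ≤ n := by positivity
      nlinarith
    · have hlt : c * r ^ (k - 1) < n := not_le.mp (Nat.find_min hex (Nat.sub_lt hpos one_pos))
      have hrec : c * r ^ k = r * (c * r ^ (k - 1)) := by
        obtain ⟨l, hl⟩ := Nat.exists_eq_succ_of_ne_zero hpos.ne'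
        rw [hl, Nat.succ_sub_one, pow_succ]; ring
      rw [hrec]
      have : 0 < c * r ^ (k - 1) := by positivity
      exact mul_le_mul hrε hlt.le this.le (by positivity)
  have hval : ((P ^ (u * k) * Q ^ (v * K + j - v * k) : ℕ) : ℝ) = c * r ^ k := by
    have hvk : v * k ≤ v * K + j := (Nat.mul_le_mul_left v hkK).trans (Nat.le_add_right _ _)
    push_cast
    rw [hc, hr, div_pow, ← pow_mul, ← pow_mul, pow_sub₀ _ hQ0.ne' hvk]
    field_simp
  refine ⟨u * k, v * K + j - v * k, ?_, ?_⟩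
  · rw [← hval] at hkn
    exact_mod_cast hkn
  · rw [hval]; exact hkub

theorem irrational_log_two_div_log_twelve : Irrational (Real.log 2 / Real.log 12) := by
  rintro ⟨q, hq⟩
  have h2 : 0 < Real.log 2 := Real.log_pos (by norm_num)
  have h12 : 0 < Real.log 12 := Real.log_pos (by norm_num)
  have hqpos : 0 < q := by
    have : (0 : ℝ) < q := by rw [hq]; positivity
    exact_mod_cast this
  have hnum : ((q.num.toNat : ℕ) : ℝ) = (q.num : ℝ) := by
    have := Int.toNat_of_nonneg (Rat.num_pos.mpr hqpos).le
    exact_mod_cast this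
  have hden : (0 : ℝ) < q.den := by exact_mod_cast q.den_pos
  have key : (q.den : ℝ) * Real.log 2 = (q.num.toNat : ℝ) * Real.log 12 := by
    rw [Rat.cast_def] at hq
    rw [hnum]
    field_simp at hq
    linarith
  rw [← Real.log_pow, ← Real.log_pow] at key
  have key2 := Real.log_injOn_pos (Set.mem_Ioi.mpr (by positivity))
    (Set.mem_Ioi.mpr (by positivity)) key
  have key3 : 2 ^ q.den = 12 ^ q.num.toNat := by exact_mod_cast key2
  have h3 : 3 ∣ 2 ^ q.den := by
    rw [key3]
    refine dvd_pow (by norm_num) ?_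
    have := Rat.num_pos.mpr hqpos
    omega
  have := (Nat.prime_three.dvd_of_dvd_pow h3)
  omega

theorem exists_two_pow_mul_twelve_pow_between {ε : ℝ} (hε : 0 < ε) :
    ∃ N : ℕ, ∀ n : ℕ, N < n → ∃ a b : ℕ, n ≤ 2 ^ a * 12 ^ b ∧
      ((2 ^ a * 12 ^ b : ℕ) : ℝ) ≤ (1 + ε) * n := by
  have hδ : 0 < Real.log (1 + ε) := Real.log_pos (by linarith)
  -- Density of `ℤ log 2 + ℤ log 12` gives an arbitrarily small positive combination. Keeping it
  -- below `log 2` forces the two coefficients not to be both positive.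
  obtain ⟨t, ht, hmem⟩ := (dense_addSubgroupClosure_pair_iff.mpr
    irrational_log_two_div_log_twelve).exists_between
      (lt_min hδ (Real.log_pos (by norm_num : (1 : ℝ) < 2)))
  obtain ⟨a, b, hab⟩ := AddSubgroup.mem_closure_pair.mp ht
  simp only [zsmul_eq_mul] at hab
  obtain ⟨h0, h1⟩ := hmem
  obtain ⟨h1, hlog⟩ := lt_min_iff.mp h1
  have h2 : 0 < Real.log 2 := Real.log_pos (by norm_num)
  have h12 : 0 < Real.log 12 := Real.log_pos (by norm_num)
  have conv : ∀ (P Q : ℝ) (u v : ℕ), 0 < P → 0 < Q →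
      u * Real.log P - v * Real.log Q = t → Q ^ v < P ^ u ∧ P ^ u ≤ (1 + ε) * Q ^ v := by
    intro P Q u v hP hQ h
    constructor
    · rw [← Real.log_lt_log_iff (by positivity) (by positivity), Real.log_pow, Real.log_pow]
      linarith
    · rw [← Real.log_le_log_iff (by positivity) (by positivity),
        Real.log_mul (by positivity) (by positivity), Real.log_pow, Real.log_pow]
      linarith
  by_cases hb : b ≤ 0
  · have ha : 0 ≤ a := by
      by_contra hc
      have hb' : (b : ℝ) ≤ 0 := by exact_mod_cast hb
      have ha' : (a : ℝ) < 0 := by exact_mod_cast not_le.mp hc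
      nlinarith
    lift a to ℕ using ha
    obtain ⟨v, hv⟩ := Int.exists_eq_neg_ofNat hb
    subst hv
    obtain ⟨hl, hu⟩ := conv 2 12 a v (by norm_num) (by norm_num) (by push_cast at hab; linarith)
    exact exists_pow_mul_pow_between (P := 2) (Q := 12) (by norm_num) (u := a) (v := v)
      (by exact_mod_cast hl) (by exact_mod_cast hu)
  · have hb0 : 0 ≤ b := (not_le.mp hb).le
    lift b to ℕ using hb0
    by_cases ha : a ≤ 0
    · obtain ⟨v, hv⟩ := Int.exists_eq_neg_ofNat ha
      subst hv
      obtain ⟨hl, hu⟩ := conv 12 2 b v (by norm_num) (by norm_num) (by push_cast at hab; linarith)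
      obtain ⟨N, hN⟩ := exists_pow_mul_pow_between (P := 12) (Q := 2) (by norm_num) (u := b) (v := v)
        (by exact_mod_cast hl) (by exact_mod_cast hu)
      refine ⟨N, fun n hn => ?_⟩
      obtain ⟨x, y, h⟩ := hN n hn
      exact ⟨y, x, by rwa [mul_comm]⟩
    · have ha1 : (1 : ℝ) ≤ a := by exact_mod_cast not_le.mp ha
      have hb1 : (0 : ℝ) ≤ (b : ℤ) := by exact_mod_cast b.zero_le
      nlinarith

theorem exists_isHadamardOrder_between {ε : ℝ} (hε : 0 < ε) :
    ∃ N : ℕ, ∀ n : ℕ, N < n → ∃ m : ℕ, IsHadamardOrder m ∧ n ≤ m ∧ (m : ℝ) ≤ (1 + ε) * n := by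
  obtain ⟨N, hN⟩ := exists_two_pow_mul_twelve_pow_between hε
  refine ⟨N, fun n hn => ?_⟩
  obtain ⟨a, b, h⟩ := hN n hn
  exact ⟨_, (isHadamardOrder_two.pow a).mul (isHadamardOrder_twelve.pow b), h⟩

/-! ### The ℓ₂ estimate -/

/-- Parseval's identity for Hadamard matrices, restricted to some of the columns. -/
theorem Matrix.IsHadamard.sum_norm_sq {ι κ : Type*} [Fintype ι] [DecidableEq ι] [Fintype κ]
    [DecidableEq κ] {H : Matrix ι ι ℤ} (hH : H.IsHadamard) {f : κ → ι}
    (hf : Function.Injective f) (y : κ → ℂ) :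
    ∑ i, ‖∑ j, (H i (f j) : ℂ) * y j‖ ^ 2 = Fintype.card ι * ∑ j, ‖y j‖ ^ 2 := by
  have horth : ∀ j k : κ, ∑ i, (H i (f j) : ℂ) * (H i (f k) : ℂ) =
      if j = k then (Fintype.card ι : ℂ) else 0 := by
    intro j k
    have h := congr_fun (congr_fun hH.conjTranspose_mul (f j)) (f k)
    simp only [Matrix.mul_apply, Matrix.conjTranspose_apply, star_trivial, Matrix.smul_apply,
      Matrix.one_apply, hf.eq_iff] at h
    have h' := congr_arg (Int.cast : ℤ → ℂ) h
    push_cast at h'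
    rw [h']
    split_ifs <;> simp
  have key : (∑ i, ((‖∑ j, (H i (f j) : ℂ) * y j‖ : ℂ)) ^ 2) =
      Fintype.card ι * ∑ j, (‖y j‖ : ℂ) ^ 2 := by
    calc ∑ i, ((‖∑ j, (H i (f j) : ℂ) * y j‖ : ℂ)) ^ 2
        = ∑ i, ∑ j, ∑ k, ((H i (f j) : ℂ) * (H i (f k) : ℂ)) *
            (y j * (starRingEnd ℂ) (y k)) := by
          refine Finset.sum_congr rfl fun i _ => ?_
          rw [← Complex.mul_conj', map_sum, Finset.sum_mul_sum]
          refine Finset.sum_congr rfl fun j _ => Finset.sum_congr rfl fun k _ => ?_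
          rw [map_mul, map_intCast]
          ring
      _ = ∑ j, ∑ k, (∑ i, (H i (f j) : ℂ) * (H i (f k) : ℂ)) *
            (y j * (starRingEnd ℂ) (y k)) := by
          rw [Finset.sum_comm]
          refine Finset.sum_congr rfl fun j _ => ?_
          rw [Finset.sum_comm]
          simp only [Finset.sum_mul]
      _ = Fintype.card ι * ∑ j, (‖y j‖ : ℂ) ^ 2 := by
          simp only [horth, ite_mul, zero_mul, Finset.sum_ite_eq, Finset.mem_univ, if_true,
            Complex.mul_conj', Finset.mul_sum]
  exact_mod_cast key

/-- The `ℓ₂` bound for a submatrix of a Hadamard matrix. -/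
theorem Matrix.IsHadamard.norm_bilinear_sum_le {ι κ₁ κ₂ : Type*} [Fintype ι] [DecidableEq ι]
    [Fintype κ₁] [Fintype κ₂] [DecidableEq κ₂] {H : Matrix ι ι ℤ} (hH : H.IsHadamard)
    {e : κ₁ → ι} (he : Function.Injective e) {f : κ₂ → ι} (hf : Function.Injective f)
    {x : κ₁ → ℂ} {y : κ₂ → ℂ} (hx : ∑ i, ‖x i‖ ^ 2 ≤ 1) (hy : ∑ j, ‖y j‖ ^ 2 ≤ 1) :
    ‖∑ i, ∑ j, (H (e i) (f j) : ℂ) * x i * y j‖ ≤ √(Fintype.card ι) := by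
  have h1 : ∑ i, ‖∑ j, (H (e i) (f j) : ℂ) * y j‖ ^ 2 ≤ Fintype.card ι := by
    calc ∑ i, ‖∑ j, (H (e i) (f j) : ℂ) * y j‖ ^ 2
        ≤ ∑ i, ‖∑ j, (H i (f j) : ℂ) * y j‖ ^ 2 := by
          refine (Finset.sum_map Finset.univ ⟨e, he⟩
            (fun i => ‖∑ j, (H i (f j) : ℂ) * y j‖ ^ 2)).symm.le.trans ?_
          exact Finset.sum_le_sum_of_subset_of_nonneg (Finset.subset_univ _)
            fun _ _ _ => by positivity
      _ = Fintype.card ι * ∑ j, ‖y j‖ ^ 2 := hH.sum_norm_sq hf y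
      _ ≤ Fintype.card ι := mul_le_of_le_one_right (by positivity) hy
  calc ‖∑ i, ∑ j, (H (e i) (f j) : ℂ) * x i * y j‖
      ≤ ∑ i, ‖∑ j, (H (e i) (f j) : ℂ) * x i * y j‖ := norm_sum_le _ _
    _ = ∑ i, ‖x i‖ * ‖∑ j, (H (e i) (f j) : ℂ) * y j‖ := by
        refine Finset.sum_congr rfl fun i _ => ?_
        rw [← norm_mul, Finset.mul_sum]
        congr 1
        exact Finset.sum_congr rfl fun j _ => by ring
    _ ≤ √(∑ i, ‖x i‖ ^ 2) * √(∑ i, ‖∑ j, (H (e i) (f j) : ℂ) * y j‖ ^ 2) :=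
        Real.sum_mul_le_sqrt_mul_sqrt _ _ _
    _ ≤ 1 * √(Fintype.card ι) := by
        gcongr
        exact Real.sqrt_le_one.mpr hx
    _ = √(Fintype.card ι) := one_mul _

/-! ### Complex interpolation -/

/-- The analytic family `z ↦ (x / |x|) |x| ^ (p (1 - z / 2))`. -/
noncomputable def analyticPower (p : ℝ) (x z : ℂ) : ℂ :=
  x / ‖x‖ * Complex.exp (p * (1 - z / 2) * Real.log ‖x‖)

theorem differentiable_analyticPower (p : ℝ) (x : ℂ) : Differentiable ℂ (analyticPower p x) := by
  unfold analyticPower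
  fun_prop

/-- The condition on `z.re` keeps the exponent positive, so both sides vanish at `x = 0`. -/
theorem norm_analyticPower {p : ℝ} (hp : 0 < p) (x : ℂ) {z : ℂ} (hz : z.re < 2) :
    ‖analyticPower p x z‖ = ‖x‖ ^ (p * (1 - z.re / 2)) := by
  rcases eq_or_ne x 0 with rfl | hx
  · have : p * (1 - z.re / 2) ≠ 0 := (mul_pos hp (by linarith)).ne'
    simp [analyticPower, Real.zero_rpow this]
  · have hx' : 0 < ‖x‖ := norm_pos_iff.mpr hx
    rw [analyticPower, norm_mul, norm_div, Complex.norm_real, norm_norm, div_self hx'.ne', one_mul,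
      Complex.norm_exp, Real.rpow_def_of_pos hx', Complex.re_mul_ofReal, Complex.re_ofReal_mul,
      mul_comm (Real.log _)]
    simp

theorem analyticPower_eq_self {p : ℝ} (x : ℂ) {z : ℂ} (hz : (p : ℂ) * (1 - z / 2) = 1) :
    analyticPower p x z = x := by
  rcases eq_or_ne x 0 with rfl | hx
  · simp [analyticPower]
  · have hx' : 0 < ‖x‖ := norm_pos_iff.mpr hx
    rw [analyticPower, hz, one_mul, ← Complex.ofReal_exp, Real.exp_log hx',
      div_mul_cancel₀ _ (by exact_mod_cast hx'.ne')]

theorem norm_le_one_of_sum_rpow_le_one {κ E : Type*} [Fintype κ] [SeminormedAddCommGroup E]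
    {p : ℝ} (hp : 0 < p) {w : κ → E} (hw : ∑ i, ‖w i‖ ^ p ≤ 1) (i : κ) : ‖w i‖ ≤ 1 := by
  by_contra hc
  have h1 := Real.one_lt_rpow (not_le.mp hc) hp
  have h2 := Finset.single_le_sum (f := fun i => ‖w i‖ ^ p)
    (fun i _ => Real.rpow_nonneg (norm_nonneg _) _) (Finset.mem_univ i)
  linarith

/-- Interpolation between `ℓ₁ × ℓ₁` and `ℓ₂ × ℓ₂` for bilinear forms with coefficients of modulus
at most one. -/
theorem norm_sum_le_rpow_of_l2_bound {κ₁ κ₂ : Type*} [Fintype κ₁] [Fintype κ₂]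
    {a : κ₁ → κ₂ → ℂ} (ha : ∀ i j, ‖a i j‖ ≤ 1) {C : ℝ}
    (hC : ∀ (x : κ₁ → ℂ) (y : κ₂ → ℂ), ∑ i, ‖x i‖ ^ 2 ≤ 1 → ∑ j, ‖y j‖ ^ 2 ≤ 1 →
      ‖∑ i, ∑ j, a i j * x i * y j‖ ≤ C)
    {p : ℝ} (hp₁ : 1 ≤ p) (hp₂ : p ≤ 2) {x : κ₁ → ℂ} {y : κ₂ → ℂ}
    (hx : ∑ i, ‖x i‖ ^ p ≤ 1) (hy : ∑ j, ‖y j‖ ^ p ≤ 1) :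
    ‖∑ i, ∑ j, a i j * x i * y j‖ ≤ C ^ (2 * (1 - 1 / p)) := by
  have hp : 0 < p := by linarith
  set F : ℂ → ℂ := fun z => ∑ i, ∑ j, a i j * analyticPower p (x i) z * analyticPower p (y j) z
    with hF
  have hFd : Differentiable ℂ F := by
    refine Differentiable.fun_sum fun i _ => Differentiable.fun_sum fun j _ => ?_
    exact ((differentiable_const _).mul (differentiable_analyticPower p (x i))).mul
      (differentiable_analyticPower p (y j))
  have hle : ∀ {w z : ℂ}, ‖w‖ ≤ 1 → z.re ≤ 1 → ‖analyticPower p w z‖ ≤ 1 := by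
    intro w z hw hz
    rw [norm_analyticPower hp w (by linarith)]
    exact Real.rpow_le_one (norm_nonneg _) hw (mul_nonneg hp.le (by linarith))
  have hprod : ∀ z, ‖F z‖ ≤ (∑ i, ‖analyticPower p (x i) z‖) * ∑ j, ‖analyticPower p (y j) z‖ := by
    intro z
    rw [Finset.sum_mul_sum]
    refine (norm_sum_le _ _).trans (Finset.sum_le_sum fun i _ => (norm_sum_le _ _).trans
      (Finset.sum_le_sum fun j _ => ?_))
    rw [norm_mul, norm_mul]
    gcongr
    exact mul_le_of_le_one_left (norm_nonneg _) (ha i j)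
  have hB : BddAbove ((norm ∘ F) '' Complex.HadamardThreeLines.verticalClosedStrip 0 1) := by
    refine ⟨(∑ _i : κ₁, 1) * ∑ _j : κ₂, 1, ?_⟩
    rintro _ ⟨z, hz, rfl⟩
    have hz1 : z.re ≤ 1 := hz.2
    refine (hprod z).trans ?_
    gcongr with i _ j _
    · exact hle (norm_le_one_of_sum_rpow_le_one hp hx i) hz1
    · exact hle (norm_le_one_of_sum_rpow_le_one hp hy j) hz1
  have h0 : ∀ z ∈ Complex.re ⁻¹' ({0} : Set ℝ), ‖F z‖ ≤ 1 := by
    intro z hz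
    have hz : z.re = 0 := hz
    refine (hprod z).trans ?_
    simp only [norm_analyticPower hp _ (show z.re < 2 by linarith), hz, zero_div, sub_zero, mul_one]
    exact mul_le_one₀ hx (Finset.sum_nonneg fun _ _ => by positivity) hy
  have hsq : ∀ {w z : ℂ}, z.re = 1 → ‖analyticPower p w z‖ ^ 2 = ‖w‖ ^ p := by
    intro w z hz
    rw [norm_analyticPower hp _ (show z.re < 2 by linarith), hz, ← Real.rpow_mul_natCast
      (norm_nonneg _)]
    congr 1
    push_cast
    ring
  have h1 : ∀ z ∈ Complex.re ⁻¹' ({1} : Set ℝ), ‖F z‖ ≤ C := by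
    intro z hz
    have hz : z.re = 1 := hz
    exact hC _ _ (by simpa only [hsq hz] using hx) (by simpa only [hsq hz] using hy)
  -- Chosen so that `1/p = (1 - θ) + θ/2`: the analytic family returns `x` and `y` at `z = θ`.
  set θ : ℝ := 2 * (1 - 1 / p) with hθ
  have hθ0 : 0 ≤ θ := by
    have : 1 / p ≤ 1 := (div_le_one hp).mpr hp₁
    linarith
  have hθ1 : θ ≤ 1 := by
    have : 1 / 2 ≤ 1 / p := one_div_le_one_div_of_le hp hp₂
    linarith
  have hpθ : (p : ℂ) * (1 - (θ : ℂ) / 2) = 1 := by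
    have : p * (1 - θ / 2) = 1 := by rw [hθ]; field_simp; ring
    exact_mod_cast this
  have main := Complex.HadamardThreeLines.norm_le_interp_of_mem_verticalClosedStrip' (f := F)
    (z := (θ : ℂ)) (a := 1) (b := C) (zero_lt_one) ⟨by simpa using hθ0, by simpa using hθ1⟩
    hFd.diffContOnCl hB h0 h1
  simpa [hF, analyticPower_eq_self _ hpθ] using main

/-! ### Scalars, exponents and unit balls -/

/-- Transfers the complex estimate to either scalar field; a ring homomorphism fixes the integer
coefficients. -/
theorem RCLike.exists_ringHom_complex_norm_eq (𝕜 : Type*) [RCLike 𝕜] :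
    ∃ φ : 𝕜 →+* ℂ, ∀ x, ‖φ x‖ = ‖x‖ := by
  rcases RCLike.I_eq_zero_or_im_I_eq_one (K := 𝕜) with h | h
  · refine ⟨Complex.ofRealHom.comp (RCLike.realRingEquiv h).toRingHom, fun x => ?_⟩
    exact (Complex.norm_real _).trans ((RCLike.realLinearIsometryEquiv h).norm_map x)
  · exact ⟨(RCLike.complexRingEquiv h).toRingHom,
      fun x => (RCLike.complexLinearIsometryEquiv h).norm_map x⟩

theorem recip_conjExponent (p : ℝ≥0∞) [Fact (1 ≤ p)] : recip p.conjExponent = 1 - recip p := by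
  have h := ENNReal.HolderConjugate.inv_add_inv_eq_one p p.conjExponent
  have hp : p⁻¹ ≠ ∞ := fun hc => by simp [hc] at h
  have hq : p.conjExponent⁻¹ ≠ ∞ := fun hc => by simp [hc] at h
  have h' := congr_arg ENNReal.toReal h
  rw [ENNReal.toReal_add hp hq, ENNReal.toReal_one] at h'
  unfold recip
  linarith

theorem recip_eq_one_div (p : ℝ≥0∞) : recip p = 1 / p.toReal := by
  rw [recip, ENNReal.toReal_inv, one_div]

theorem one_le_toReal_of_le_two {p : ℝ≥0∞} [hp : Fact (1 ≤ p)] (h : p ≤ 2) :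
    1 ≤ p.toReal := by
  simpa using ENNReal.toReal_mono (ne_top_of_le_ne_top (by simp) h) hp.out

theorem toReal_le_two {p : ℝ≥0∞} (h : p ≤ 2) : p.toReal ≤ 2 := by
  simpa using ENNReal.toReal_mono (by simp) h

theorem half_le_recip {p : ℝ≥0∞} [Fact (1 ≤ p)] (h : p ≤ 2) : 1 / 2 ≤ recip p := by
  rw [recip_eq_one_div]
  exact one_div_le_one_div_of_le (by linarith [one_le_toReal_of_le_two h]) (toReal_le_two h)

theorem recip_le_one (p : ℝ≥0∞) [Fact (1 ≤ p)] : recip p ≤ 1 := by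
  have h := recip_conjExponent p
  have h0 : 0 ≤ recip p.conjExponent := ENNReal.toReal_nonneg
  linarith

theorem recip_anti {p q : ℝ≥0∞} [hp : Fact (1 ≤ p)] (h : p ≤ q) : recip q ≤ recip p :=
  ENNReal.toReal_mono (ENNReal.inv_ne_top.mpr (one_pos.trans_le hp.out).ne')
    (ENNReal.inv_le_inv.mpr h)

theorem bennettBound_comm (p₁ p₂ : ℝ≥0∞) (n₁ n₂ : ℕ) :
    bennettBound p₁ p₂ n₁ n₂ = bennettBound p₂ p₁ n₂ n₁ :=
  max_comm _ _

theorem bennettBound_eq {p₁ p₂ : ℝ≥0∞} [Fact (1 ≤ p₁)] [Fact (1 ≤ p₂)] {n₁ n₂ : ℕ}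
    (hn₁ : 0 < n₁) (hp : p₁ ≤ p₂) (hp₂ : p₂ ≤ 2) (hn : n₁ ≤ n₂) :
    bennettBound p₁ p₂ n₁ n₂ = (n₂ : ℝ) ^ recip p₂.conjExponent := by
  have h₁ := half_le_recip (hp.trans hp₂)
  have h₂ := half_le_recip hp₂
  rw [bennettBound, max_eq_right (show 1 / 2 - recip p₁ ≤ 0 by linarith),
    max_eq_right (show 1 / 2 - recip p₂ ≤ 0 by linarith), Real.rpow_zero, Real.rpow_zero, mul_one,
    mul_one, recip_conjExponent, recip_conjExponent]
  refine max_eq_left ?_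
  have h1n : (1 : ℝ) ≤ n₁ := by exact_mod_cast hn₁
  have hnn : (n₁ : ℝ) ≤ n₂ := by exact_mod_cast hn
  calc (n₁ : ℝ) ^ (1 - recip p₁) ≤ (n₁ : ℝ) ^ (1 - recip p₂) :=
        Real.rpow_le_rpow_of_exponent_le h1n (by linarith [recip_anti hp])
    _ ≤ (n₂ : ℝ) ^ (1 - recip p₂) :=
        Real.rpow_le_rpow (by positivity) hnn (by linarith [recip_le_one p₂])

theorem PiLp.sum_rpow_le_one_of_norm_le_one {E κ : Type*} [Fintype κ] [SeminormedAddCommGroup E]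
    {p q : ℝ≥0∞} [Fact (1 ≤ p)] (hpq : p ≤ q) (hq : q ≤ 2) {x : PiLp p (fun _ : κ => E)}
    (hx : ‖x‖ ≤ 1) : ∑ i, ‖x i‖ ^ q.toReal ≤ 1 := by
  have hp : 0 < p.toReal := by linarith [one_le_toReal_of_le_two (hpq.trans hq)]
  have hsum : ∑ i, ‖x i‖ ^ p.toReal ≤ 1 := by
    rw [PiLp.norm_eq_sum hp] at hx
    have h0 : 0 ≤ ∑ i, ‖x i‖ ^ p.toReal := Finset.sum_nonneg fun _ _ => by positivity
    by_contra hc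
    exact absurd (Real.one_lt_rpow (not_le.mp hc) (one_div_pos.mpr hp)) (not_lt.mpr hx)
  -- Coordinates have norm at most 1, so raising the exponent decreases each term.
  refine (Finset.sum_le_sum fun i _ => ?_).trans hsum
  exact Real.rpow_le_rpow_of_exponent_ge' (norm_nonneg _)
    (norm_le_one_of_sum_rpow_le_one hp hsum i) hp.le
    (ENNReal.toReal_mono (ne_top_of_le_ne_top (by simp) hq) hpq)

theorem LinearMap.norm_le_mul_of_unit_ball {𝕜 E F : Type*} [RCLike 𝕜] [NormedAddCommGroup E]
    [NormedSpace 𝕜 E] [NormedAddCommGroup F] [NormedSpace 𝕜 F] (B : E →ₗ[𝕜] F →ₗ[𝕜] 𝕜) {C : ℝ}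
    (hB : ∀ x y, ‖x‖ ≤ 1 → ‖y‖ ≤ 1 → ‖B x y‖ ≤ C) (x : E) (y : F) :
    ‖B x y‖ ≤ C * ‖x‖ * ‖y‖ := by
  rcases eq_or_ne x 0 with rfl | hx
  · simp
  rcases eq_or_ne y 0 with rfl | hy
  · simp
  have hx' : 0 < ‖x‖ := norm_pos_iff.mpr hx
  have hy' : 0 < ‖y‖ := norm_pos_iff.mpr hy
  have h := hB (((‖x‖ : 𝕜)⁻¹) • x) (((‖y‖ : 𝕜)⁻¹) • y) (norm_smul_inv_norm hx).le
    (norm_smul_inv_norm hy).le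
  rw [map_smul, map_smul, LinearMap.smul_apply, norm_smul, norm_smul, norm_inv, norm_inv,
    RCLike.norm_ofReal, RCLike.norm_ofReal, abs_norm, abs_norm] at h
  field_simp at h
  linarith

/-! ### Construction of the form -/

/-- The bilinear form with the given coefficients. -/
def coeffBilin {𝕜 : Type*} [RCLike 𝕜] (p₁ p₂ : ℝ≥0∞) {n₁ n₂ : ℕ} (s : Fin n₁ → Fin n₂ → 𝕜) :
    PiLp p₁ (fun _ : Fin n₁ => 𝕜) →ₗ[𝕜] PiLp p₂ (fun _ : Fin n₂ => 𝕜) →ₗ[𝕜] 𝕜 :=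
  LinearMap.mk₂ 𝕜 (fun x y => ∑ i, ∑ j, s i j * x i * y j)
    (fun x x' y => by simp [mul_add, add_mul, Finset.sum_add_distrib])
    (fun c x y => by
      simp only [PiLp.smul_apply, smul_eq_mul, Finset.mul_sum]
      exact Finset.sum_congr rfl fun i _ => Finset.sum_congr rfl fun j _ => by ring)
    (fun x y y' => by simp [mul_add, Finset.sum_add_distrib])
    (fun c x y => by
      simp only [PiLp.smul_apply, smul_eq_mul, Finset.mul_sum]
      exact Finset.sum_congr rfl fun i _ => Finset.sum_congr rfl fun j _ => by ring)

theorem IsHadamardOrder.exists_bilinForm {m : ℕ} (hm : IsHadamardOrder m) (𝕜 : Type*) [RCLike 𝕜]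
    {p₁ p₂ q : ℝ≥0∞} [Fact (1 ≤ p₁)] [Fact (1 ≤ p₂)] [Fact (1 ≤ q)] {n₁ n₂ : ℕ} (hn₁ : n₁ ≤ m)
    (hn₂ : n₂ ≤ m) (hp₁ : p₁ ≤ q) (hp₂ : p₂ ≤ q) (hq : q ≤ 2) :
    ∃ A : BilinForm 𝕜 p₁ p₂ n₁ n₂, HasSignCoefficients A ∧ ‖A‖ ≤ (m : ℝ) ^ (1 - recip q) := by
  obtain ⟨H, hH⟩ := hm
  obtain ⟨φ, hφ⟩ := RCLike.exists_ringHom_complex_norm_eq 𝕜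
  have hsign : ∀ i j, H i j = 1 ∨ H i j = -1 := fun i j =>
    Unitary.mem_iff_eq_one_or_eq_neg_one.mp (hH.apply_mem i j)
  set s : Fin n₁ → Fin n₂ → 𝕜 := fun i j => (H (Fin.castLE hn₁ i) (Fin.castLE hn₂ j) : 𝕜) with hs
  have hbound : ∀ (x : PiLp p₁ (fun _ : Fin n₁ => 𝕜)) (y : PiLp p₂ (fun _ : Fin n₂ => 𝕜)),
      ‖x‖ ≤ 1 → ‖y‖ ≤ 1 → ‖coeffBilin p₁ p₂ s x y‖ ≤ (m : ℝ) ^ (1 - recip q) := by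
    intro x y hx hy
    have h := norm_sum_le_rpow_of_l2_bound (p := q.toReal) (C := √m)
      (a := fun i j => (H (Fin.castLE hn₁ i) (Fin.castLE hn₂ j) : ℂ))
      (fun i j => by rcases hsign (Fin.castLE hn₁ i) (Fin.castLE hn₂ j) with h | h <;> simp [h])
      (fun x y hx hy => by
        simpa using hH.norm_bilinear_sum_le (Fin.castLE_injective hn₁) (Fin.castLE_injective hn₂)
          hx hy)
      (one_le_toReal_of_le_two hq) (toReal_le_two hq) (x := fun i => φ (x i)) (y := fun j => φ (y j))
      (by simpa only [hφ] using PiLp.sum_rpow_le_one_of_norm_le_one hp₁ hq hx)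
      (by simpa only [hφ] using PiLp.sum_rpow_le_one_of_norm_le_one hp₂ hq hy)
    rw [Real.sqrt_eq_rpow, ← Real.rpow_mul (Nat.cast_nonneg m), ← recip_eq_one_div] at h
    have he : 1 / 2 * (2 * (1 - recip q)) = 1 - recip q := by ring
    rw [he] at h
    rw [← hφ]
    simpa [coeffBilin, hs] using h
  refine ⟨(coeffBilin p₁ p₂ s).mkContinuous₂ ((m : ℝ) ^ (1 - recip q))
    (LinearMap.norm_le_mul_of_unit_ball _ hbound), ⟨s, fun i j => ?_, fun x y => ?_⟩,
    LinearMap.mkContinuous₂_norm_le _ (by positivity) _⟩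
  · rcases hsign (Fin.castLE hn₁ i) (Fin.castLE hn₂ j) with h | h <;> simp [hs, h]
  · simp [coeffBilin]

theorem rpow_one_sub_recip_le {p : ℝ≥0∞} [Fact (1 ≤ p)] {ε m n : ℝ} (hε : 0 ≤ ε) (hm₀ : 0 ≤ m)
    (hn : 0 ≤ n) (hm : m ≤ (1 + ε) * n) :
    m ^ (1 - recip p) ≤ (1 + ε) * n ^ recip p.conjExponent := by
  have h1 := recip_le_one p
  have h0 : 0 ≤ recip p := ENNReal.toReal_nonneg
  rw [recip_conjExponent]
  calc m ^ (1 - recip p) ≤ ((1 + ε) * n) ^ (1 - recip p) :=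
        Real.rpow_le_rpow hm₀ hm (by linarith)
    _ = (1 + ε) ^ (1 - recip p) * n ^ (1 - recip p) := Real.mul_rpow (by linarith) hn
    _ ≤ (1 + ε) ^ (1 : ℝ) * n ^ (1 - recip p) := by
        gcongr
        · linarith
        · linarith
    _ = (1 + ε) * n ^ (1 - recip p) := by rw [Real.rpow_one]

theorem mainTheorem7 (ε : ℝ) (hε : 0 < ε) :
    ∃ N : ℕ, 0 < N ∧
      ∀ (𝕜 : Type*) [RCLike 𝕜] (p₁ p₂ : ℝ≥0∞) [Fact (1 ≤ p₁)] [Fact (1 ≤ p₂)] (n₁ n₂ : ℕ),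
        0 < n₁ → 0 < n₂ →
        (p₁ ≤ p₂ → p₂ ≤ 2 → N < n₂ → n₁ ≤ n₂ →
          bennettBound p₁ p₂ n₁ n₂ = (n₂ : ℝ) ^ recip p₂.conjExponent ∧
          ∃ A : BilinForm 𝕜 p₁ p₂ n₁ n₂,
            HasSignCoefficients A ∧ ‖A‖ ≤ (1 + ε) * bennettBound p₁ p₂ n₁ n₂) ∧
        (p₂ ≤ p₁ → p₁ ≤ 2 → N < n₁ → n₂ ≤ n₁ →
          bennettBound p₁ p₂ n₁ n₂ = (n₁ : ℝ) ^ recip p₁.conjExponent ∧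
          ∃ A : BilinForm 𝕜 p₁ p₂ n₁ n₂,
            HasSignCoefficients A ∧ ‖A‖ ≤ (1 + ε) * bennettBound p₁ p₂ n₁ n₂) := by
  obtain ⟨N, hN⟩ := exists_isHadamardOrder_between hε
  -- The successor only serves to make the threshold positive.
  refine ⟨N + 1, N.succ_pos, fun 𝕜 _ p₁ p₂ _ _ n₁ n₂ hn₁ hn₂ => ⟨?_, ?_⟩⟩
  · intro hp hp₂ hNn hn
    have hB := bennettBound_eq (n₂ := n₂) hn₁ hp hp₂ hn
    obtain ⟨m, hm, hnm, hmn⟩ := hN n₂ (by omega)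
    obtain ⟨A, hA, hAn⟩ := hm.exists_bilinForm 𝕜 (hn.trans hnm) hnm hp le_rfl hp₂
    refine ⟨hB, A, hA, hAn.trans ?_⟩
    rw [hB]
    exact rpow_one_sub_recip_le hε.le (by positivity) (by positivity) hmn
  · intro hp hp₁ hNn hn
    have hB := (bennettBound_comm p₁ p₂ n₁ n₂).trans (bennettBound_eq (n₂ := n₁) hn₂ hp hp₁ hn)
    obtain ⟨m, hm, hnm, hmn⟩ := hN n₁ (by omega)
    obtain ⟨A, hA, hAn⟩ := hm.exists_bilinForm 𝕜 hnm (hn.trans hnm) le_rfl hp hp₁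
    refine ⟨hB, A, hA, hAn.trans ?_⟩
    rw [hB]
    exact rpow_one_sub_recip_le hε.le (by positivity) (by positivity) hmn
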